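/- Let $X$ be a finite CW complex with oriented cells, and let $d\ge 1$. The oriented cells give the cellular bases of the integral cellular chain groups $C_n(X;\mathbb Z)=H_n(X^n,X^{n-1};\mathbb Z)$. Let $S_d$ be the set of $d$-cells, let $\langle\cdot,\cdot\rangle$ be the pairing on $C_d(X;\mathbb Z)$ for which the cellular basis $S_d$ is orthonormal, let $Z_d(X;\mathbb Z)=\ker\partial_d$ have rank $z_d$, and let $b_{d-1}$ be the rank of $B_{d-1}(X;\mathbb Z)=\operatorname{im}\partial_d$. Fix an ordered basis $z_1,\dots,z_{z_d}$ of the free abelian group $Z_d(X;\mathbb Z)$. Let $A$ be the matrix of the inclusion $Z_d(X;\mathbb Z)\subset C_d(X;\mathbb Z)$ in this basis and the cellular basis, and let $M=(\langle z_i,z_j\rangle)_{i,j}$ be the mesh matrix, so that $M=A^tA$. Write $\sigma_j(M)$ for the $j$-th elementary symmetric function of the eigenvalues of $M$ (with multiplicity). For $V\subseteq S_d$ put $V^c=S_d\setminus V$ and $X_V=X^{(d-1)}\cup V$, a subcomplex of $X$ whose chain group $C_d(X_V)$ is spanned by the oriented cells of $V$. The set $V$ is a ($d$-dimensional) spanning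 forest if $|V|=b_{d-1}$ and $\partial_d\colon C_d(X_V;\mathbb R)\to B_{d-1}(X;\mathbb R)$ is an isomorphism. The set $W\subseteq S_d$ is a $k$-augmented spanning forest if it is the union of a spanning forest and $k$ further $d$-cells; then $Z_d(X_W;\mathbb Z)$ has rank $k$. Let $t_{d-1}(\cdot)$ be the order of the torsion subgroup of $H_{d-1}(\cdot\,;\mathbb Z)$. Let $j_W\colon Z_d(X;\mathbb Z)\subset C_d(X;\mathbb Z)\to C_d(X_{W^c};\mathbb Z)$ be the restriction, and $j_W^*$ its adjoint for the inner products in which $\{z_r\}$ and the cellular basis are orthonormal; $\det(j_Wj_W^*)$ is called the covolume squared of $j_W^*$. Let $B[W]$ be the matrix of the inclusion $Z_d(X_W;\mathbb Z)\subset Z_d(X;\mathbb Z)$ with respect to any basis of $Z_d(X_W;\mathbb Z)$ and the basis $\{z_r\}$. Then the following hold. 1. The constant coefficient of $(-1)^{z_d}\det(t\,\mathrm{Id}-M)$ is $$\det M=\text{product of the eigenvalues of }M=\sigma_{z_d}(M)=\sum_{V\text{ a spanning forest}}\Bigl(\frac{t_{d-1}(X_V)}{t_{d-1}(X)}\Bigr)^2,$$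 and for every spanning forest $V$, $\det(j_Vj_V^*)=\bigl(t_{d-1}(X_V)/t_{d-1}(X)\bigr)^2$. 2. For $0<k<z_d$, the coefficient of $(-1)^{z_d-k}t^k$ in $\det(t\,\mathrm{Id}-M)$ is $$\sigma_{z_d-k}(M)=\sum_{W\text{ a }k\text{-augmented spanning forest}}\Bigl(\frac{t_{d-1}(X_W)}{t_{d-1}(X)}\Bigr)^2\det\bigl(B[W]^tB[W]\bigr).$$ 3. For $0\le k<z_d$ and every $k$-augmented spanning forest $W$, $$\det(j_Wj_W^*)=\Bigl(\frac{t_{d-1}(X_W)}{t_{d-1}(X)}\Bigr)^2\det\bigl(B[W]^tB[W]\bigr).$$ 4. For every $k$-augmented spanning forest $W$ (in particular for $k=0$), the quotient $t_{d-1}(X_W)/t_{d-1}(X)$ is a positive integer. -/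

import Mathlib

open CategoryTheory Topology Module
open scoped TensorProduct

noncomputable section

namespace CellMesh

universe u

section Singular

variable (X : Type u) [TopologicalSpace X]

/-- The singular chain complex of the space `X` with integral coefficients. -/
abbrev singularComplex : ChainComplex (ModuleCat.{u} ℤ) ℕ :=
  ((AlgebraicTopology.singularChainComplexFunctor (ModuleCat.{u} ℤ)).obj
    (ModuleCat.of ℤ (ULift.{u} ℤ))).obj (TopCat.of X)

variable {X}

/-- The singular `n`-chains of `X` that lie in the subspace `A`. -/
def singularChains (n : ℕ) (A : Set X) : AddSubgroup ((singularComplex X).X n) :=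
  ((((AlgebraicTopology.singularChainComplexFunctor (ModuleCat.{u} ℤ)).obj
    (ModuleCat.of ℤ (ULift.{u} ℤ))).map
      (TopCat.ofHom (⟨Subtype.val, continuous_subtype_val⟩ : C(A, X)))).f n).hom.toAddMonoidHom.range

/-- The boundary map on singular chains (it is zero unless `j + 1 = i`). -/
def singularD (X : Type u) [TopologicalSpace X] (i j : ℕ) :
    (singularComplex X).X i →+ (singularComplex X).X j :=
  ((singularComplex X).d i j).hom.toAddMonoidHom

theorem singularD_mem (i j : ℕ) {A : Set X} {c : (singularComplex X).X i}
    (hc : c ∈ singularChains i A) : singularD X i j c ∈ singularChains j A := by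
  obtain ⟨y, rfl⟩ := hc
  refine ⟨((((AlgebraicTopology.singularChainComplexFunctor (ModuleCat.{u} ℤ)).obj
    (ModuleCat.of ℤ (ULift.{u} ℤ))).obj (TopCat.of A)).d i j).hom y, ?_⟩
  have h := (((AlgebraicTopology.singularChainComplexFunctor (ModuleCat.{u} ℤ)).obj
    (ModuleCat.of ℤ (ULift.{u} ℤ))).map
      (TopCat.ofHom (⟨Subtype.val, continuous_subtype_val⟩ : C(A, X)))).comm i j
  exact (congrArg (fun f => f.hom y) h).symm

theorem singularD_singularD (i j k : ℕ) (c : (singularComplex X).X i) :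
    singularD X j k (singularD X i j c) = 0 :=
  congrArg (fun f => f.hom c) ((singularComplex X).d_comp_d i j k)

theorem singularD_shape {i j : ℕ} (h : j + 1 ≠ i) (c : (singularComplex X).X i) :
    singularD X i j c = 0 :=
  congrArg (fun f => f.hom c) ((singularComplex X).shape i j (by simpa using h))

/-- Relative singular `n`-cycles of the pair `(A, B)`, where `B ⊆ A ⊆ X`: chains in `A` whose
boundary lies in `B`. -/
def relCycles (n : ℕ) (A B : Set X) : AddSubgroup ((singularComplex X).X n) :=
  singularChains n A ⊓ (singularChains (n - 1) B).comap (singularD X n (n - 1))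

/-- Relative singular `n`-boundaries of the pair `(A, B)`, where `B ⊆ A ⊆ X`. -/
def relBoundaries (n : ℕ) (A B : Set X) : AddSubgroup ((singularComplex X).X n) :=
  singularChains n B ⊔ (singularChains (n + 1) A).map (singularD X (n + 1) n)

/-- The relative singular homology group `H_n(A, B; ℤ)`, where `B ⊆ A ⊆ X`. -/
def RelHomology (n : ℕ) (A B : Set X) : Type u :=
  relCycles n A B ⧸ (relBoundaries n A B).addSubgroupOf (relCycles n A B)

instance (n : ℕ) (A B : Set X) : AddCommGroup (RelHomology n A B) :=
  inferInstanceAs (AddCommGroup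
    (relCycles n A B ⧸ (relBoundaries n A B).addSubgroupOf (relCycles n A B)))

/-- The class of a relative cycle. -/
def relClass {n : ℕ} {A B : Set X} : relCycles n A B →+ RelHomology n A B :=
  QuotientAddGroup.mk' _

theorem relClass_surjective {n : ℕ} {A B : Set X} :
    Function.Surjective (relClass : relCycles n A B →+ RelHomology n A B) :=
  QuotientAddGroup.mk'_surjective _

end Singular

section Cellular

variable {X : Type u} [TopologicalSpace X] [T2Space X] (C : Set X) [CWComplex C]

/-- The subspace `X^{n-1}`, the `(n - 1)`-skeleton (empty for `n = 0`). -/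
abbrev skelLT (n : ℕ) : Set X := RelCWComplex.skeletonLT C (n : ℕ∞)

/-- The integral cellular chain group `C_n(X; ℤ) = H_n(X^n, X^{n-1}; ℤ)` of a CW complex. -/
abbrev Chain (n : ℕ) : Type u := RelHomology n (skelLT C (n + 1)) (skelLT C n)

theorem singularD_mem_relCycles (i j : ℕ) {c : (singularComplex X).X i}
    (hc : c ∈ relCycles i (skelLT C (i + 1)) (skelLT C i)) :
    singularD X i j c ∈ relCycles j (skelLT C (j + 1)) (skelLT C j) := by
  by_cases h : j + 1 = i
  · subst h
    refine AddSubgroup.mem_inf.2 ⟨hc.2, AddSubgroup.mem_comap.2 ?_⟩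
    rw [singularD_singularD]
    exact zero_mem _
  · rw [singularD_shape h]
    exact zero_mem _

/-- The singular boundary, from relative cycles of `(X^i, X^{i-1})` to relative cycles of
`(X^j, X^{j-1})`. -/
def relCyclesD (i j : ℕ) :
    relCycles i (skelLT C (i + 1)) (skelLT C i) →+ relCycles j (skelLT C (j + 1)) (skelLT C j) :=
  ((singularD X i j).comp (AddSubgroup.subtype _)).codRestrict _
    fun c => singularD_mem_relCycles C i j c.2

theorem relCyclesD_wellDefined (i j : ℕ) :
    (relBoundaries i (skelLT C (i + 1)) (skelLT C i)).addSubgroupOf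
        (relCycles i (skelLT C (i + 1)) (skelLT C i)) ≤
      ((relBoundaries j (skelLT C (j + 1)) (skelLT C j)).addSubgroupOf
        (relCycles j (skelLT C (j + 1)) (skelLT C j))).comap (relCyclesD C i j) := by
  rintro ⟨c, hc⟩ hb
  change singularD X i j c ∈ relBoundaries j _ _
  by_cases h : j + 1 = i
  · subst h
    obtain ⟨a, ha, b, hb', hab⟩ := AddSubgroup.mem_sup.1 (show c ∈ relBoundaries _ _ _ from hb)
    obtain ⟨e, _, rfl⟩ := hb'
    rw [← hab, map_add, singularD_singularD, add_zero]
    exact (le_sup_right : _ ≤ relBoundaries j (skelLT C (j + 1)) (skelLT C j)) ⟨a, ha, rfl⟩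
  · rw [singularD_shape h]
    exact zero_mem _

/-- The cellular boundary map `C_i(X; ℤ) → C_j(X; ℤ)` (zero unless `j + 1 = i`): the connecting
homomorphism of the triple `(X^i, X^{i-1}, X^{i-2})`, i.e. `[c] ↦ [∂c]`. -/
def boundary (i j : ℕ) : Chain C i →ₗ[ℤ] Chain C j :=
  (QuotientAddGroup.map _ _ (relCyclesD C i j) (relCyclesD_wellDefined C i j) :
    Chain C i →+ Chain C j).toIntLinearMap

theorem boundary_relClass (i j : ℕ) (c : relCycles i (skelLT C (i + 1)) (skelLT C i)) :
    boundary C i j (relClass c) = relClass (relCyclesD C i j c) := rfl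

theorem boundary_boundary (i j k : ℕ) (x : Chain C i) :
    boundary C j k (boundary C i j x) = 0 := by
  obtain ⟨c, rfl⟩ := relClass_surjective x
  rw [boundary_relClass, boundary_relClass]
  have h : relCyclesD C j k (relCyclesD C i j c) = 0 :=
    Subtype.ext (singularD_singularD _ _ _ c.1)
  rw [h, map_zero]

/-- The integral cycles `Z_n(X; ℤ)`. -/
def cycles (n : ℕ) : Submodule ℤ (Chain C n) :=
  LinearMap.ker (boundary C n (n - 1))

/-- `z_n`, the rank of `Z_n(X; ℤ)`. -/
def cycleRank (n : ℕ) : ℕ := finrank ℤ (cycles C n)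

/-- The integral boundaries `B_n(X; ℤ)`. -/
def boundaries (n : ℕ) : Submodule ℤ (Chain C n) :=
  LinearMap.range (boundary C (n + 1) n)

/-- `b_n`, the rank of `B_n(X; ℤ)`. -/
def boundaryRank (n : ℕ) : ℕ := finrank ℤ (boundaries C n)

/-- The cellular boundary map on real cellular chains `C_n(X; ℝ) = ℝ ⊗ C_n(X; ℤ)`. -/
def realBoundary (i j : ℕ) : ℝ ⊗[ℤ] Chain C i →ₗ[ℝ] ℝ ⊗[ℤ] Chain C j :=
  (boundary C i j).baseChange ℝ

/-- The real boundaries `B_n(X; ℝ)`. -/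
def realBoundaries (n : ℕ) : Submodule ℝ (ℝ ⊗[ℤ] Chain C n) :=
  LinearMap.range (realBoundary C (n + 1) n)

/-- An orientation of the cells of a CW complex, given as its cellular basis: a basis of every
`C_n(X; ℤ) = H_n(X^n, X^{n-1}; ℤ)` indexed by the `n`-cells, in which the basis element of a cell
`e` is the image of a class in `H_n(ē, ∂e; ℤ)`, for the closed cell `ē` and its frontier `∂e`.
As `C_n(X; ℤ)` is the direct sum of the groups `H_n(ē, ∂e; ℤ) ≅ ℤ`, this is the same as a choice
of one of the two generators of each of these groups. -/
structure Orientation where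
  basis (n : ℕ) : Basis (RelCWComplex.cell C n) ℤ (Chain C n)
  basis_mem (n : ℕ) (e : RelCWComplex.cell C n) :
    ∃ c : relCycles n (skelLT C (n + 1)) (skelLT C n),
      (c : (singularComplex X).X n) ∈
          relCycles n (RelCWComplex.closedCell n e) (RelCWComplex.cellFrontier n e) ∧
        relClass c = basis n e

instance cellFintype [RelCWComplex.FiniteType C] (n : ℕ) : Fintype (RelCWComplex.cell C n) :=
  @Fintype.ofFinite _ (RelCWComplex.FiniteType.finite_cell (C := C) n)

/-- `X` as a subcomplex of itself. -/
def wholeComplex : CWComplex.Subcomplex C :=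
  CWComplex.Subcomplex.mk' C C (fun _ => Set.univ)
    (fun n i => RelCWComplex.closedCell_subset_complex n (i : RelCWComplex.cell C n))
    (by simpa using CWComplex.iUnion_openCell_eq_complex (C := C))

variable {C}

/-- The subcomplex `X_V = X^{(d-1)} ∪ V` for a set `V` of `d`-cells. -/
def subcomplexOf {d : ℕ} (V : Finset (RelCWComplex.cell C d)) : CWComplex.Subcomplex C :=
  CWComplex.Subcomplex.mk' C
    ((RelCWComplex.skeletonLT C d : Set X) ∪ ⋃ e ∈ V, RelCWComplex.closedCell d e)
    (fun n => {e | n < d ∨ ∃ v ∈ V, (⟨n, e⟩ : Σ n, RelCWComplex.cell C n) = ⟨d, v⟩})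
    (by
      rintro n ⟨e, h | ⟨v, hv, h⟩⟩
      · refine Set.subset_union_of_subset_left ?_ _
        refine (RelCWComplex.closedCell_subset_skeletonLT n e).trans (RelCWComplex.skeletonLT_mono ?_)
        exact_mod_cast h
      · obtain ⟨hn, h⟩ := Sigma.mk.inj_iff.1 h
        subst hn
        obtain rfl := eq_of_heq h
        exact Set.subset_union_of_subset_right
          (Set.subset_biUnion_of_mem (u := fun e => RelCWComplex.closedCell n e) hv) _)
    (by
      apply Set.Subset.antisymm
      · refine Set.iUnion_subset fun n => Set.iUnion_subset ?_
        rintro ⟨e, h | ⟨v, hv, h⟩⟩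
        · refine Set.subset_union_of_subset_left ?_ _
          refine (RelCWComplex.openCell_subset_skeletonLT n e).trans
            (RelCWComplex.skeletonLT_mono ?_)
          exact_mod_cast h
        · obtain ⟨hn, h⟩ := Sigma.mk.inj_iff.1 h
          subst hn
          obtain rfl := eq_of_heq h
          exact Set.subset_union_of_subset_right
            ((RelCWComplex.openCell_subset_closedCell n _).trans
              (Set.subset_biUnion_of_mem (u := fun e => RelCWComplex.closedCell n e) hv)) _
      · have key : (skelLT C d : Set X) ⊆ ⋃ (n : ℕ) (j : {e : RelCWComplex.cell C n |
            n < d ∨ ∃ v ∈ V, (⟨n, e⟩ : Σ n, RelCWComplex.cell C n) = ⟨d, v⟩}),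
            RelCWComplex.openCell (C := C) n j := by
          intro x hx
          rw [skelLT, ← CWComplex.iUnion_openCell_eq_skeletonLT] at hx
          simp only [Set.mem_iUnion] at hx ⊢
          obtain ⟨m, hm, j, hj⟩ := hx
          exact ⟨m, ⟨j, Or.inl (by exact_mod_cast hm)⟩, hj⟩
        refine Set.union_subset key (Set.iUnion₂_subset fun v hv => ?_)
        rw [← RelCWComplex.cellFrontier_union_openCell_eq_closedCell]
        refine Set.union_subset ((RelCWComplex.cellFrontier_subset_skeletonLT d v).trans key) ?_
        intro x hx
        simp only [Set.mem_iUnion]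
        exact ⟨d, ⟨v, Or.inr ⟨v, hv, rfl⟩⟩, hx⟩)

variable (o : Orientation C)

/-- The cellular chains `C_n(E; ℤ)` of a subcomplex `E`, inside `C_n(X; ℤ)`: the free abelian
group on the oriented `n`-cells of `E`. -/
def chainsOf (E : CWComplex.Subcomplex C) (n : ℕ) : Submodule ℤ (Chain C n) :=
  Submodule.span ℤ (o.basis n '' E.I n)

/-- The integral cycles `Z_n(E; ℤ)` of a subcomplex `E`, inside `C_n(X; ℤ)`. -/
def cyclesOf (E : CWComplex.Subcomplex C) (n : ℕ) : Submodule ℤ (Chain C n) :=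
  cycles C n ⊓ chainsOf o E n

/-- The integral boundaries `B_n(E; ℤ)` of a subcomplex `E`, inside `C_n(X; ℤ)`. -/
def boundariesOf (E : CWComplex.Subcomplex C) (n : ℕ) : Submodule ℤ (Chain C n) :=
  (chainsOf o E (n + 1)).map (boundary C (n + 1) n)

/-- The integral (cellular) homology group `H_n(E; ℤ)` of a subcomplex `E`. -/
abbrev HomologyOf (E : CWComplex.Subcomplex C) (n : ℕ) : Type u :=
  cyclesOf o E n ⧸ (boundariesOf o E n).submoduleOf (cyclesOf o E n)

/-- `t_n(E)`, the order of the torsion subgroup of `H_n(E; ℤ)`. -/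
def torsionOrder (E : CWComplex.Subcomplex C) (n : ℕ) : ℕ :=
  Nat.card (Submodule.torsion ℤ (HomologyOf o E n))

/-- The set `V` of `d`-cells is a spanning forest of dimension `d`: it has `b_{d-1}` elements and
`∂ : C_d(X_V; ℝ) → B_{d-1}(X; ℝ)` is an isomorphism. -/
def IsSpanningForest {d : ℕ} (V : Finset (RelCWComplex.cell C d)) : Prop :=
  V.card = boundaryRank C (d - 1) ∧
    Set.BijOn (realBoundary C d (d - 1))
      ((chainsOf o (subcomplexOf V) d).baseChange ℝ : Submodule ℝ (ℝ ⊗[ℤ] Chain C d))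
      (realBoundaries C (d - 1))

/-- `W` is a `k`-augmented spanning forest: a spanning forest with `k` further `d`-cells added. -/
def IsAugmentedForest {d : ℕ} (k : ℕ) (W : Finset (RelCWComplex.cell C d)) : Prop :=
  ∃ V : Finset (RelCWComplex.cell C d), IsSpanningForest o V ∧ V ⊆ W ∧ W.card = V.card + k

open Classical in
/-- The finite set of all `d`-dimensional spanning forests. -/
def spanningForests [RelCWComplex.FiniteType C] (d : ℕ) : Finset (Finset (RelCWComplex.cell C d)) :=
  Finset.univ.filter fun V => IsSpanningForest o V

open Classical in
/-- The finite set of all `d`-dimensional `k`-augmented spanning forests. -/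
def augmentedForests [RelCWComplex.FiniteType C] (d k : ℕ) :
    Finset (Finset (RelCWComplex.cell C d)) :=
  Finset.univ.filter fun W => IsAugmentedForest o k W

/-- The pairing of integral chains for which the cellular basis is orthonormal. -/
def pairing [RelCWComplex.FiniteType C] {d : ℕ} (a b : Chain C d) : ℤ :=
  ∑ e : RelCWComplex.cell C d, (o.basis d).repr a e * (o.basis d).repr b e

variable {d : ℕ} (z : Basis (Fin (cycleRank C d)) ℤ (cycles C d))

/-- The mesh matrix `M{z_r}` of the basis `z` of the integral cycles. -/
def meshMatrix [RelCWComplex.FiniteType C] : Matrix (Fin (cycleRank C d)) (Fin (cycleRank C d)) ℤ :=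
  Matrix.of fun i j => pairing o (z i : Chain C d) (z j : Chain C d)

/-- The matrix `A{z_r}` of the inclusion `Z_d(X; ℤ) ⊆ C_d(X; ℤ)` in the basis `z` and the
cellular basis. -/
def inclusionMatrix [RelCWComplex.FiniteType C] :
    Matrix (RelCWComplex.cell C d) (Fin (cycleRank C d)) ℤ :=
  LinearMap.toMatrix z (o.basis d) (cycles C d).subtype

/-- The eigenvalues, with multiplicity, of an integral square matrix. -/
def eigenvaluesOf {n : ℕ} (M : Matrix (Fin n) (Fin n) ℤ) : Multiset ℂ :=
  (M.map (Int.cast : ℤ → ℂ)).charpoly.roots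

/-- The restriction `j_W : Z_d(X; ℤ) ⊆ C_d(X; ℤ) → C_d(X_{Wᶜ}; ℤ)`; the target is the free abelian
group on the `d`-cells outside `W`. -/
def restrictionMap (W : Finset (RelCWComplex.cell C d)) :
    cycles C d →ₗ[ℤ] ({e : RelCWComplex.cell C d // e ∉ W} → ℤ) :=
  LinearMap.pi fun e => (o.basis d).coord e ∘ₗ (cycles C d).subtype

open Classical in
/-- The adjoint `j_W^*` of `j_W`, for the inner products in which the basis `z` of `Z_d(X; ℤ)` and
the cellular basis of `C_d(X_{Wᶜ}; ℤ)` are orthonormal: its matrix is the transpose. -/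
def restrictionAdjoint [RelCWComplex.FiniteType C] (W : Finset (RelCWComplex.cell C d)) :
    ({e : RelCWComplex.cell C d // e ∉ W} → ℤ) →ₗ[ℤ] cycles C d :=
  Matrix.toLin (Pi.basisFun ℤ _) z
    (LinearMap.toMatrix z (Pi.basisFun ℤ _) (restrictionMap o W)).transpose

/-- The covolume squared `det (j_W j_W^*)`. -/
def covolumeSq [RelCWComplex.FiniteType C] (W : Finset (RelCWComplex.cell C d)) : ℤ :=
  LinearMap.det (restrictionMap o W ∘ₗ restrictionAdjoint o z W)

/-- The inclusion `m_W : Z_d(X_W; ℤ) ⊆ Z_d(X; ℤ)`. -/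
def cyclesInclusion (W : Finset (RelCWComplex.cell C d)) :
    cyclesOf o (subcomplexOf W) d →ₗ[ℤ] cycles C d :=
  Submodule.inclusion inf_le_left

/-- The matrix `B[W]` of `m_W` in the basis `y` of `Z_d(X_W; ℤ)` and the basis `z`. -/
def augMatrix (W : Finset (RelCWComplex.cell C d))
    (y : Basis (Fin (finrank ℤ (cyclesOf o (subcomplexOf W) d))) ℤ
      (cyclesOf o (subcomplexOf W) d)) :
    Matrix (Fin (cycleRank C d)) (Fin (finrank ℤ (cyclesOf o (subcomplexOf W) d))) ℤ :=
  LinearMap.toMatrix y z (cyclesInclusion o W)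

/-- The quotient `t_{d-1}(X_W) / t_{d-1}(X)`. -/
def torsionRatio (W : Finset (RelCWComplex.cell C d)) : ℚ :=
  (torsionOrder o (subcomplexOf W) (d - 1) : ℚ) / (torsionOrder o (wholeComplex C) (d - 1) : ℚ)

end Cellular

end CellMesh

end

open CellMesh

/-! As `M = AᵀA`, the coefficients of its characteristic polynomial are, up to sign, sums of
principal minors of `A Aᵀ`. The matrix of `j_W` consists of the rows of `A` outside `W`, so the
minor on the complement of `W` is `det (j_W j_W*)`. A nonzero minor forces the image of `j_W` to
have finite index, and it remains to evaluate these minors.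

For a map `f` from a based lattice to `ℤ^ι` with image of finite index, a basis adapted to `ker f`
and duality of complementary minors give `det (f fᵀ)` as the square of that index times the Gram
determinant of `ker f` (`LinearMap.det_toMatrix_mul_transpose`). For `f = j_W` the kernel is
`Z_d(X_W)`, whence the factor `det (B[W]ᵗ B[W])`.

The index of the image of `j_W` is the index of `Z_d(X) + C_d(X_W)` in `C_d(X)`, which `∂` turns
into `[B_{d-1}(X) : B_{d-1}(X_W)]` (`index_range_restrictionMap`). The two homology groups in degree
`d - 1` are quotients of the same `Z_{d-1}(X)`, so this index, when finite, is the torsion ratio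
(`torsionRatio_eq`); it is finite exactly when `W` contains a spanning forest. -/

/-! ### Principal minors and Gram determinants of lattice maps -/

open Polynomial in
theorem Matrix.charpoly_transpose_mul_self_coeff {R m n : Type*} [CommRing R] [Fintype m]
    [DecidableEq m] [Fintype n] [DecidableEq n] (A : Matrix m n R)
    (h : Fintype.card n ≤ Fintype.card m) (k : ℕ) (hk : k ≤ Fintype.card n) :
    (-1) ^ (Fintype.card n - k) * (A.transpose * A).charpoly.coeff k =
      ∑ s ∈ Finset.univ.powersetCard (Fintype.card n - k),
        ((A * A.transpose).submatrix (Subtype.val : s → m) (Subtype.val : s → m)).det := by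
  -- The characteristic polynomial of `A Aᵀ` is that of `AᵀA` times `X ^ (|m| - |n|)`; this shift
  -- makes degree `k` correspond to minors of size `|n| - k`.
  have h1 := Matrix.charpoly_mul_comm_of_le A A.transpose h
  have h2 := Matrix.charpoly_coeff_eq_sum_minors (A * A.transpose) (Fintype.card n - k)
    ((Nat.sub_le _ _).trans h)
  have h3 : Fintype.card m - (Fintype.card n - k) = k + (Fintype.card m - Fintype.card n) := by
    omega
  rw [h1, h3, mul_comm (X ^ _), coeff_mul_X_pow] at h2
  rw [h2, ← mul_assoc, ← mul_pow]
  simp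

/-- Complementary minors of a positive definite unimodular matrix and its inverse. -/
theorem Matrix.det_mul_transpose_toRows₂_eq {m κ ι : Type*} [Fintype m] [DecidableEq m]
    [Fintype κ] [DecidableEq κ] [Fintype ι] [DecidableEq ι] (e : κ ⊕ ι ≃ m)
    (P : Matrix m (κ ⊕ ι) ℤ) (Q : Matrix (κ ⊕ ι) m ℤ) (hPQ : P * Q = 1) (hQP : Q * P = 1) :
    (Q.toRows₂ * Q.toRows₂.transpose).det = (P.toCols₁.transpose * P.toCols₁).det := by
  set G := P.transpose * P with hG
  set X := Q * Q.transpose with hX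
  have hGX : G * X = 1 := by
    rw [hG, hX, Matrix.mul_assoc, ← Matrix.mul_assoc P, hPQ, Matrix.one_mul,
      ← Matrix.transpose_mul, hQP, Matrix.transpose_one]
  -- Once `P` is reindexed by `e` to be square, `det G` is the square of its determinant, so it is a
  -- unit of `ℤ` other than `-1`.
  have hdG : G.det = 1 := by
    have h1 : G = (P.submatrix e id).transpose * P.submatrix e id := by
      rw [hG, Matrix.transpose_submatrix, Matrix.submatrix_mul_equiv]
      simp
    have h2 : IsUnit G.det := IsUnit.of_mul_eq_one X.det (by rw [← Matrix.det_mul, hGX, Matrix.det_one])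
    rw [h1, Matrix.det_mul, Matrix.det_transpose] at h2 ⊢
    rcases Int.isUnit_iff.1 (isUnit_of_mul_isUnit_left h2) with h | h <;> simp [h]
  -- Jacobi's argument: the second block column of `G X = 1`, completed by a trivial first column,
  -- compares `det X₂₂` with `det G₁₁`.
  have hblock : G * Matrix.fromBlocks 1 X.toBlocks₁₂ 0 X.toBlocks₂₂ =
      Matrix.fromBlocks G.toBlocks₁₁ 0 G.toBlocks₂₁ 1 := by
    have hb := hGX
    rw [← Matrix.fromBlocks_toBlocks G, ← Matrix.fromBlocks_toBlocks X,
      Matrix.fromBlocks_multiply, ← Matrix.fromBlocks_one, Matrix.fromBlocks_inj] at hb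
    conv_lhs => rw [← Matrix.fromBlocks_toBlocks G]
    rw [Matrix.fromBlocks_multiply, hb.2.1, hb.2.2.2]
    simp
  have hdet := congrArg Matrix.det hblock
  rw [Matrix.det_mul, hdG, Matrix.det_fromBlocks_zero₂₁, Matrix.det_fromBlocks_zero₁₂] at hdet
  simp only [Matrix.det_one, one_mul, mul_one] at hdet
  exact hdet

/-- The covolume formula for a homomorphism of lattices with image of finite index. -/
theorem LinearMap.det_toMatrix_mul_transpose {Z K m κ ι : Type*} [AddCommGroup Z]
    [AddCommGroup K] [Fintype m] [DecidableEq m] [Fintype κ]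
    [DecidableEq κ] [Fintype ι] [DecidableEq ι] (z : Basis m ℤ Z) (y : Basis κ ℤ K)
    (g : K →ₗ[ℤ] Z) (f : Z →ₗ[ℤ] (ι → ℤ)) (hg : Function.Injective g)
    (hgf : LinearMap.range g = LinearMap.ker f)
    (hf : f.range.toAddSubgroup.index ≠ 0) :
    (LinearMap.toMatrix z (Pi.basisFun ℤ ι) f *
        (LinearMap.toMatrix z (Pi.basisFun ℤ ι) f).transpose).det =
      (f.range.toAddSubgroup.index : ℤ) ^ 2 *
        ((LinearMap.toMatrix y z g).transpose * LinearMap.toMatrix y z g).det := by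
  have hfin : Finite ((ι → ℤ) ⧸ f.range) := Nat.finite_of_card_ne_zero hf
  have hrank : finrank ℤ f.range = Fintype.card ι := by
    rw [(Submodule.finiteQuotient_iff _).1 hfin, finrank_fintype_fun_eq_card]
  let r : Basis ι ℤ f.range :=
    (finBasisOfFinrankEq ℤ f.range hrank).reindex (Fintype.equivFin ι).symm
  let yk : Basis κ ℤ (LinearMap.ker f) :=
    y.map ((LinearEquiv.ofInjective g hg).trans (LinearEquiv.ofEq _ _ hgf))
  -- An adapted basis: the given basis of the kernel, then lifts of a basis of the image. In it `f`
  -- vanishes on the first block and is the square matrix `N'` on the second, with `|det N'|` the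
  -- index of the image.
  let u : Basis (κ ⊕ ι) ℤ Z := Basis.sumQuot yk (r.map f.quotKerEquivRange.symm)
  have hul : ∀ i, u (Sum.inl i) = g (y i) := fun i => by simp [u, yk]
  have hur : ∀ j, f (u (Sum.inr j)) = r j := fun j => by
    have h := Basis.sumQuot_inr yk (r.map f.quotKerEquivRange.symm) j
    rw [Basis.map_apply, LinearEquiv.eq_symm_apply] at h
    rw [← h]
    rfl
  have hfl : ∀ i, f (u (Sum.inl i)) = 0 := fun i => by
    rw [hul, ← LinearMap.mem_ker, ← hgf]
    exact ⟨_, rfl⟩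
  set N' : Matrix ι ι ℤ := (Pi.basisFun ℤ ι).toMatrix (fun j => (r j : ι → ℤ)) with hN'
  have hN : LinearMap.toMatrix z (Pi.basisFun ℤ ι) f = N' * (u.toMatrix z).toRows₂ := by
    rw [← linearMap_toMatrix_mul_basis_toMatrix z u (Pi.basisFun ℤ ι) f]
    ext i j
    rw [Matrix.mul_apply, Matrix.mul_apply, Fintype.sum_sum_type]
    simp [LinearMap.toMatrix_apply, hfl, hur, N', Basis.toMatrix_apply]
  have hB : LinearMap.toMatrix y z g = (z.toMatrix u).toCols₁ := by
    ext i j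
    simp [LinearMap.toMatrix_apply, Basis.toMatrix_apply, hul]
  have hdet : N'.det ^ 2 = (f.range.toAddSubgroup.index : ℤ) ^ 2 := by
    have h := Submodule.natAbs_det_basis_change (Pi.basisFun ℤ ι) f.range r
    have h' : f.range.toAddSubgroup.index = N'.det.natAbs := h.symm
    rw [h', Int.natAbs_sq]
  rw [hB, ← Matrix.det_mul_transpose_toRows₂_eq (u.indexEquiv z) (z.toMatrix u) (u.toMatrix z)
    (Basis.toMatrix_mul_toMatrix_flip _ _) (Basis.toMatrix_mul_toMatrix_flip _ _), hN,
    Matrix.transpose_mul, Matrix.mul_assoc, ← Matrix.mul_assoc (Matrix.toRows₂ _),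
    Matrix.det_mul, Matrix.det_mul, Matrix.det_transpose, ← hdet]
  ring

/-! ### Torsion, indices and ranks of subgroups -/

/-- Torsion orders of the quotients by two submodules, one of finite index in the other. -/
theorem Submodule.card_torsion_quotient_eq {M : Type*} [AddCommGroup M]
    (N₁ N₂ : Submodule ℤ M) (h : N₁ ≤ N₂)
    (hi : N₁.toAddSubgroup.relIndex N₂.toAddSubgroup ≠ 0) :
    Nat.card (Submodule.torsion ℤ (M ⧸ N₁)) =
      N₁.toAddSubgroup.relIndex N₂.toAddSubgroup * Nat.card (Submodule.torsion ℤ (M ⧸ N₂)) := by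
  have mem_iff : ∀ (N : Submodule ℤ M) (x : M),
      x ∈ (Submodule.torsion ℤ (M ⧸ N)).comap N.mkQ ↔ ∃ a : ℤ, a ≠ 0 ∧ a • x ∈ N := by
    intro N x
    rw [Submodule.mem_comap, Submodule.mem_torsion_iff]
    constructor
    · rintro ⟨⟨a, ha⟩, h⟩
      exact ⟨a, nonZeroDivisors.ne_zero ha, (Submodule.Quotient.mk_eq_zero N).1 h⟩
    · rintro ⟨a, ha, h⟩
      exact ⟨⟨a, mem_nonZeroDivisors_of_ne_zero ha⟩, (Submodule.Quotient.mk_eq_zero N).2 h⟩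
  -- The torsion of `M ⧸ N` is the saturation of `N` modulo `N`.
  have card_eq : ∀ N : Submodule ℤ M, Nat.card (Submodule.torsion ℤ (M ⧸ N)) =
      N.toAddSubgroup.relIndex
        ((Submodule.torsion ℤ (M ⧸ N)).comap N.mkQ).toAddSubgroup := by
    intro N
    have h1 := AddSubgroup.relIndex_ker
      ((Submodule.torsion ℤ (M ⧸ N)).comap N.mkQ).toAddSubgroup N.mkQ.toAddMonoidHom
    have h2 : N.mkQ.toAddMonoidHom.ker = N.toAddSubgroup := by
      ext x
      exact Submodule.Quotient.mk_eq_zero N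
    rw [h2] at h1
    rw [h1]
    have h3 : ((Submodule.torsion ℤ (M ⧸ N)).comap N.mkQ).map N.mkQ =
        Submodule.torsion ℤ (M ⧸ N) :=
      Submodule.map_comap_eq_of_surjective N.mkQ_surjective _
    exact Nat.card_congr (Equiv.setCongr (congrArg (SetLike.coe) h3.symm))
  -- The index multiplies `N₂` into `N₁`, so both have the same saturation; indices then multiply
  -- along `N₁ ≤ N₂ ≤` saturation.
  have hT : (Submodule.torsion ℤ (M ⧸ N₁)).comap N₁.mkQ =
      (Submodule.torsion ℤ (M ⧸ N₂)).comap N₂.mkQ := by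
    ext x
    rw [mem_iff, mem_iff]
    constructor
    · rintro ⟨a, ha, hx⟩
      exact ⟨a, ha, h hx⟩
    · rintro ⟨a, ha, hx⟩
      refine ⟨N₁.toAddSubgroup.relIndex N₂.toAddSubgroup * a,
        mul_ne_zero (by exact_mod_cast hi) ha, ?_⟩
      have := AddSubgroup.nsmul_index_mem
        (N₁.toAddSubgroup.addSubgroupOf N₂.toAddSubgroup) ⟨a • x, hx⟩
      rw [mul_smul, natCast_zsmul]
      exact this
  rw [card_eq, card_eq, hT, AddSubgroup.relIndex_mul_relIndex _ _ _ h]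
  intro x hx
  exact (mem_iff _ _).2 ⟨1, one_ne_zero, by simpa using hx⟩

theorem Submodule.relIndex_ne_zero_iff_finrank_eq {M : Type*} [AddCommGroup M] [Module.Free ℤ M]
    [Module.Finite ℤ M] {N₁ N₂ : Submodule ℤ M} (h : N₁ ≤ N₂) :
    N₁.toAddSubgroup.relIndex N₂.toAddSubgroup ≠ 0 ↔ finrank ℤ N₁ = finrank ℤ N₂ := by
  have h1 := Submodule.finiteQuotient_iff (N₁.submoduleOf N₂)
  rw [(Submodule.submoduleOfEquivOfLe h).finrank_eq] at h1
  rw [← h1]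
  exact AddSubgroup.index_ne_zero_iff_finite (H := N₁.toAddSubgroup.addSubgroupOf N₂.toAddSubgroup)

/-- For maps `p` (surjective) and `q`, the image of `ker q` under `p` and the image of `ker p`
under `q` have the same index. -/
theorem LinearMap.index_map_ker_eq_relIndex {F P Q : Type*} [AddCommGroup F]
    [AddCommGroup P] [AddCommGroup Q] (p : F →ₗ[ℤ] P) (q : F →ₗ[ℤ] Q)
    (hp : Function.Surjective p) :
    ((LinearMap.ker q).map p).toAddSubgroup.index =
      ((LinearMap.ker p).map q).toAddSubgroup.relIndex (LinearMap.range q).toAddSubgroup := by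
  have h1 : ((LinearMap.ker q).map p).toAddSubgroup =
      q.toAddMonoidHom.ker.map p.toAddMonoidHom := rfl
  have h2 : ((LinearMap.ker p).map q).toAddSubgroup =
      p.toAddMonoidHom.ker.map q.toAddMonoidHom := rfl
  have h3 : (LinearMap.range q).toAddSubgroup = q.toAddMonoidHom.range := rfl
  -- Both sides equal the index of `ker p ⊔ ker q` in `F`.
  rw [h1, h2, h3, AddSubgroup.index_map, AddMonoidHom.range_eq_top_of_surjective _ hp,
    AddSubgroup.index_top, mul_one, ← AddSubgroup.index_comap, AddSubgroup.comap_map_eq, sup_comm]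

theorem Submodule.finrank_baseChange_real {M : Type*} [AddCommGroup M] [Module.Free ℤ M]
    [Module.Finite ℤ M] (N : Submodule ℤ M) :
    finrank ℝ (N.baseChange ℝ) = finrank ℤ N := by
  have hinj : Function.Injective (N.subtype.baseChange ℝ) :=
    Module.Flat.lTensor_preserves_injective_linearMap N.subtype N.subtype_injective
  exact (LinearMap.finrank_range_of_inj hinj).trans Module.finrank_baseChange

theorem Submodule.map_baseChange_real {M P : Type*} [AddCommGroup M] [AddCommGroup P]
    (f : M →ₗ[ℤ] P) (N : Submodule ℤ M) :
    (N.baseChange ℝ).map (f.baseChange ℝ) = (N.map f).baseChange ℝ := by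
  rw [Submodule.baseChange_eq_span, Submodule.baseChange_eq_span, Submodule.map_span]
  congr 1
  ext x
  simp

theorem LinearMap.injOn_of_map_eq_of_finrank_eq {K E F : Type*} [Field K] [AddCommGroup E]
    [AddCommGroup F] [Module K E] [Module K F] [FiniteDimensional K E] (f : E →ₗ[K] F)
    (D : Submodule K E) (B : Submodule K F) (hmap : D.map f = B)
    (hrank : finrank K D = finrank K B) : Set.InjOn f D := by
  subst hmap
  have : FiniteDimensional K (D.map f) := inferInstance
  have hinj := (LinearMap.injective_iff_surjective_of_finrank_eq_finrank hrank
    (f := f.submoduleMap D)).2 (f.submoduleMap_surjective D)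
  intro x hx x' hx' h
  exact congrArg Subtype.val (hinj (a₁ := ⟨x, hx⟩) (a₂ := ⟨x', hx'⟩) (Subtype.ext h))

theorem LinearMap.finrank_range_add_finrank_ker_int {M P : Type*} [AddCommGroup M]
    [AddCommGroup P] [Module.Finite ℤ M] (f : M →ₗ[ℤ] P) :
    finrank ℤ (LinearMap.range f) + finrank ℤ (LinearMap.ker f) = finrank ℤ M := by
  rw [← f.quotKerEquivRange.finrank_eq, Submodule.finrank_quotient_add_finrank]

/-! ### Chains, boundaries and torsion orders of subcomplexes -/

namespace CellMesh

universe u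

variable {X : Type u} [TopologicalSpace X] [T2Space X] {C : Set X} [CWComplex C]

theorem chainsOf_subcomplexOf (o : Orientation C) {d : ℕ} (W : Finset (RelCWComplex.cell C d)) :
    chainsOf o (subcomplexOf W) d = Submodule.span ℤ (o.basis d '' W) := by
  unfold chainsOf
  congr 2
  ext e
  change (d < d ∨ ∃ v ∈ W, (⟨d, e⟩ : Σ n, RelCWComplex.cell C n) = ⟨d, v⟩) ↔ _
  simp

theorem chainsOf_subcomplexOf_of_lt (o : Orientation C) {d n : ℕ} (h : n < d)
    (W : Finset (RelCWComplex.cell C d)) : chainsOf o (subcomplexOf W) n = ⊤ := by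
  have hI : (subcomplexOf W).I n = Set.univ :=
    Set.eq_univ_of_forall fun e => (Or.inl h :
      n < d ∨ ∃ v ∈ W, (⟨n, e⟩ : Σ n, RelCWComplex.cell C n) = ⟨d, v⟩)
  rw [chainsOf, hI, Set.image_univ, Basis.span_eq]

theorem chainsOf_wholeComplex (o : Orientation C) (n : ℕ) :
    chainsOf o (wholeComplex C) n = ⊤ := by
  have hI : (wholeComplex C).I n = Set.univ := rfl
  rw [chainsOf, hI, Set.image_univ, Basis.span_eq]

/-- Allows `X_W` and `X`, which share their `(d-1)`-cells, to be compared through quotients of one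
group of cycles. -/
theorem torsionOrder_eq (o : Orientation C) (E : CWComplex.Subcomplex C) (n : ℕ)
    (h : chainsOf o E n = ⊤) :
    torsionOrder o E n =
      Nat.card (Submodule.torsion ℤ (cycles C n ⧸ (boundariesOf o E n).submoduleOf (cycles C n))) := by
  have h' : cyclesOf o E n = cycles C n := by rw [cyclesOf, h, inf_top_eq]
  unfold torsionOrder HomologyOf
  rw [h']

theorem boundaries_le_cycles (n : ℕ) : boundaries C n ≤ cycles C n := by
  rintro _ ⟨x, rfl⟩
  exact boundary_boundary C _ _ _ x

theorem boundariesOf_le (o : Orientation C) (E : CWComplex.Subcomplex C) (n : ℕ) :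
    boundariesOf o E n ≤ boundaries C n :=
  LinearMap.map_le_range

theorem boundariesOf_wholeComplex (o : Orientation C) (n : ℕ) :
    boundariesOf o (wholeComplex C) n = boundaries C n := by
  rw [boundariesOf, chainsOf_wholeComplex, Submodule.map_top, boundaries]

theorem boundariesOf_subcomplexOf_mono (o : Orientation C) {n : ℕ}
    {V W : Finset (RelCWComplex.cell C (n + 1))} (h : V ⊆ W) :
    boundariesOf o (subcomplexOf V) n ≤ boundariesOf o (subcomplexOf W) n := by
  rw [boundariesOf, boundariesOf, chainsOf_subcomplexOf, chainsOf_subcomplexOf]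
  exact Submodule.map_mono (Submodule.span_mono (Set.image_mono (by exact_mod_cast h)))

theorem Chain.free (o : Orientation C) (n : ℕ) : Module.Free ℤ (Chain C n) :=
  Module.Free.of_basis (o.basis n)

theorem finrank_chainsOf_subcomplexOf (o : Orientation C) {d : ℕ}
    (W : Finset (RelCWComplex.cell C d)) :
    finrank ℤ (chainsOf o (subcomplexOf W) d) = W.card := by
  have hli : LinearIndependent ℤ fun e : (W : Set (RelCWComplex.cell C d)) => o.basis d e :=
    (o.basis d).linearIndependent.comp _ Subtype.val_injective
  rw [chainsOf_subcomplexOf, Set.image_eq_range, finrank_span_eq_card hli]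
  simp

theorem realBoundaries_eq (n : ℕ) :
    realBoundaries C n = (boundaries C n).baseChange ℝ := by
  rw [boundaries, LinearMap.range_eq_map, ← Submodule.map_baseChange_real,
    Submodule.baseChange_top, Submodule.map_top]
  rfl

section FiniteType

variable [RelCWComplex.FiniteType C]

theorem Chain.finite (o : Orientation C) (n : ℕ) : Module.Finite ℤ (Chain C n) :=
  Module.Finite.of_basis (o.basis n)

/-- The index of the group of boundaries of `X_W` in the group of boundaries of `X`. -/
noncomputable def boundaryIndex (o : Orientation C) {n : ℕ}
    (W : Finset (RelCWComplex.cell C (n + 1))) : ℕ :=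
  (boundariesOf o (subcomplexOf W) n).toAddSubgroup.relIndex (boundaries C n).toAddSubgroup

/-- Both homology groups are quotients of `Z_n(X)`, by nested groups of boundaries; passing to a
subgroup of finite index multiplies the torsion order of the quotient by that index. -/
theorem torsionRatio_eq (o : Orientation C) {n : ℕ} (W : Finset (RelCWComplex.cell C (n + 1)))
    (h : boundaryIndex o W ≠ 0) : torsionRatio o W = boundaryIndex o W := by
  have := Chain.free o n
  have := Chain.finite o n
  set N₁ := (boundariesOf o (subcomplexOf W) n).submoduleOf (cycles C n) with hN₁
  set N₂ := (boundaries C n).submoduleOf (cycles C n) with hN₂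
  have hle : N₁ ≤ N₂ := Submodule.comap_mono (boundariesOf_le o _ n)
  have hidx : N₁.toAddSubgroup.relIndex N₂.toAddSubgroup = boundaryIndex o W := by
    have h1 := AddSubgroup.relIndex_comap (boundariesOf o (subcomplexOf W) n).toAddSubgroup
      (cycles C n).subtype.toAddMonoidHom N₂.toAddSubgroup
    have h2 : N₂.toAddSubgroup.map (cycles C n).subtype.toAddMonoidHom =
        (boundaries C n).toAddSubgroup := by
      have h3 : N₂.map (cycles C n).subtype = boundaries C n := by
        rw [hN₂, Submodule.submoduleOf, Submodule.map_comap_subtype,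
          inf_eq_right.2 (boundaries_le_cycles n)]
      exact congrArg Submodule.toAddSubgroup h3
    rw [h2] at h1
    exact h1
  have hcard := Submodule.card_torsion_quotient_eq N₁ N₂ hle (by rwa [hidx])
  rw [hidx] at hcard
  have hW : torsionOrder o (subcomplexOf W) n = Nat.card (Submodule.torsion ℤ (cycles C n ⧸ N₁)) :=
    torsionOrder_eq o _ n (chainsOf_subcomplexOf_of_lt o n.lt_succ_self W)
  have hX : torsionOrder o (wholeComplex C) n =
      Nat.card (Submodule.torsion ℤ (cycles C n ⧸ N₂)) := by
    rw [torsionOrder_eq o _ n (chainsOf_wholeComplex o n), boundariesOf_wholeComplex]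
  -- Finite generation makes the torsion finite; otherwise `Nat.card` would be `0` and the ratio
  -- meaningless.
  have hfin : Finite (Submodule.torsion ℤ (cycles C n ⧸ N₂)) :=
    Module.finite_of_fg_torsion _ (Submodule.torsion_isTorsion)
  have hpos : (Nat.card (Submodule.torsion ℤ (cycles C n ⧸ N₂)) : ℚ) ≠ 0 := by
    exact_mod_cast Nat.card_pos.ne'
  change (torsionOrder o (subcomplexOf W) n : ℚ) / (torsionOrder o (wholeComplex C) n : ℚ) = _
  rw [hW, hX, hcard, div_eq_iff hpos]
  push_cast
  rfl

/-! ### Forests characterised by cardinality and finite boundary index (index `0` encodes an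
infinite index) -/

theorem boundaryIndex_ne_zero_iff (o : Orientation C) {n : ℕ}
    (W : Finset (RelCWComplex.cell C (n + 1))) :
    boundaryIndex o W ≠ 0 ↔
      finrank ℤ (boundariesOf o (subcomplexOf W) n) = boundaryRank C n := by
  have := Chain.free o n
  have := Chain.finite o n
  exact Submodule.relIndex_ne_zero_iff_finrank_eq (boundariesOf_le o _ n)

theorem boundariesOf_baseChange_eq_iff (o : Orientation C) {n : ℕ}
    (W : Finset (RelCWComplex.cell C (n + 1))) :
    (boundariesOf o (subcomplexOf W) n).baseChange ℝ = realBoundaries C n ↔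
      boundaryIndex o W ≠ 0 := by
  have := Chain.free o n
  have := Chain.finite o n
  rw [boundaryIndex_ne_zero_iff, boundaryRank, realBoundaries_eq,
    ← Submodule.finrank_baseChange_real, ← Submodule.finrank_baseChange_real]
  refine ⟨fun h => by rw [h], fun h => Submodule.eq_of_le_of_finrank_eq ?_ h⟩
  exact Submodule.baseChange_mono ℝ (boundariesOf_le o _ n)

/-- Finite index amounts to surjectivity over `ℝ`; injectivity then follows from equality of
dimensions. -/
theorem isSpanningForest_iff (o : Orientation C) {n : ℕ}
    (V : Finset (RelCWComplex.cell C (n + 1))) :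
    IsSpanningForest o V ↔ V.card = boundaryRank C n ∧ boundaryIndex o V ≠ 0 := by
  have := Chain.free o n
  have := Chain.finite o n
  have := Chain.free o (n + 1)
  have := Chain.finite o (n + 1)
  rw [← boundariesOf_baseChange_eq_iff]
  change (V.card = boundaryRank C n ∧ Set.BijOn (realBoundary C (n + 1) n) _
    (realBoundaries C n : Set _)) ↔ _
  refine and_congr_right fun hcard => ?_
  set D := (chainsOf o (subcomplexOf V) (n + 1)).baseChange ℝ with hD
  have himage : D.map (realBoundary C (n + 1) n) =
      (boundariesOf o (subcomplexOf V) n).baseChange ℝ :=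
    Submodule.map_baseChange_real _ _
  constructor
  · intro h
    rw [← himage]
    exact SetLike.coe_injective h.image_eq
  · intro h
    rw [h] at himage
    have himage' : realBoundary C (n + 1) n '' D = realBoundaries C n := by
      rw [← himage, Submodule.map_coe]
    refine ⟨himage' ▸ Set.mapsTo_image _ _, ?_, himage' ▸ Set.surjOn_image _ _⟩
    have hrank : finrank ℝ D = finrank ℝ (realBoundaries C n) := by
      rw [hD, Submodule.finrank_baseChange_real, realBoundaries_eq,
        Submodule.finrank_baseChange_real, finrank_chainsOf_subcomplexOf, hcard]
      rfl
    have := Module.Finite.base_change ℤ ℝ (Chain C (n + 1))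
    exact LinearMap.injOn_of_map_eq_of_finrank_eq _ _ _ himage hrank

/-- Matroid basis extraction: the boundaries of the cells of `W` span the real boundaries, so a
maximal independent subfamily is a spanning forest inside `W`. -/
theorem isAugmentedForest_iff (o : Orientation C) {n : ℕ} (k : ℕ)
    (W : Finset (RelCWComplex.cell C (n + 1))) :
    IsAugmentedForest o k W ↔ W.card = boundaryRank C n + k ∧ boundaryIndex o W ≠ 0 := by
  classical
  have := Chain.free o n
  have := Chain.finite o n
  constructor
  · rintro ⟨V, hV, hVW, hcard⟩
    rw [isSpanningForest_iff, boundaryIndex_ne_zero_iff] at hV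
    refine ⟨by rw [hcard, hV.1], ?_⟩
    rw [boundaryIndex_ne_zero_iff]
    refine le_antisymm (Submodule.finrank_mono (boundariesOf_le o _ n)) ?_
    rw [← hV.2]
    exact Submodule.finrank_mono (boundariesOf_subcomplexOf_mono o hVW)
  · rintro ⟨hcard, hW⟩
    let w : RelCWComplex.cell C (n + 1) → ℝ ⊗[ℤ] Chain C n :=
      fun e => 1 ⊗ₜ boundary C (n + 1) n (o.basis (n + 1) e)
    have hspan : ∀ V : Finset (RelCWComplex.cell C (n + 1)),
        (boundariesOf o (subcomplexOf V) n).baseChange ℝ = Submodule.span ℝ (w '' V) := by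
      intro V
      rw [boundariesOf, chainsOf_subcomplexOf, Submodule.map_span, Submodule.baseChange_span,
        ← Set.image_comp, ← Set.image_comp]
      rfl
    obtain ⟨κ, a, ha, hκ, hli⟩ := exists_linearIndependent' ℝ (fun e : W => w e)
    have : Fintype κ := Fintype.ofInjective a ha
    let V : Finset (RelCWComplex.cell C (n + 1)) := Finset.univ.image fun i => (a i : _)
    have hV : Submodule.span ℝ (w '' V) = Submodule.span ℝ (w '' W) := by
      have h1 : w '' V = Set.range ((fun e : W => w e) ∘ a) := by
        ext; simp [V]
      have h2 : w '' W = Set.range (fun e : W => w e) := by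
        ext; simp
      rw [h1, h2, hκ]
    have hVidx : boundaryIndex o V ≠ 0 := by
      rwa [← boundariesOf_baseChange_eq_iff, hspan, hV, ← hspan, boundariesOf_baseChange_eq_iff]
    have hVcard : V.card = boundaryRank C n := by
      have hinj : Function.Injective fun i => (a i : RelCWComplex.cell C (n + 1)) :=
        Subtype.val_injective.comp ha
      rw [Finset.card_image_of_injective _ hinj, Finset.card_univ, ← finrank_span_eq_card hli, hκ]
      have h2 : Set.range (fun e : W => w e) = w '' W := by
        ext; simp
      rw [h2, ← hspan, Submodule.finrank_baseChange_real, (boundaryIndex_ne_zero_iff o W).1 hW]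
    refine ⟨V, (isSpanningForest_iff o V).2 ⟨hVcard, hVidx⟩, ?_, by rw [hcard, hVcard]⟩
    intro e he
    obtain ⟨i, -, rfl⟩ := Finset.mem_image.1 he
    exact (a i).2

end FiniteType

/-! ### Kernel and image of the restriction map -/

theorem range_cyclesInclusion (o : Orientation C) {d : ℕ} (W : Finset (RelCWComplex.cell C d)) :
    LinearMap.range (cyclesInclusion o W) = LinearMap.ker (restrictionMap o W) := by
  have h : LinearMap.range (cyclesInclusion o W) =
      (cyclesOf o (subcomplexOf W) d).comap (cycles C d).subtype :=
    Submodule.range_inclusion _ _ _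
  rw [h]
  ext x
  rw [Submodule.mem_comap, cyclesOf, Submodule.mem_inf, chainsOf_subcomplexOf,
    Basis.mem_span_image, LinearMap.mem_ker, funext_iff]
  simp only [Set.subset_def, Finset.mem_coe, Finsupp.mem_support_iff, restrictionMap,
    LinearMap.pi_apply, LinearMap.comp_apply, Submodule.subtype_apply, Basis.coord_apply,
    Pi.zero_apply, Subtype.forall, x.2, true_and]
  exact forall_congr' fun e => not_imp_comm

section FiniteType

variable [RelCWComplex.FiniteType C]

/-- `LinearMap.index_map_ker_eq_relIndex` is applied to the projection `p` onto the cells outside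
`W` and to `∂`: their kernels are `C_d(X_W)` and `Z_d(X)`. -/
theorem index_range_restrictionMap (o : Orientation C) {n : ℕ}
    (W : Finset (RelCWComplex.cell C (n + 1))) :
    (LinearMap.range (restrictionMap o W)).toAddSubgroup.index = boundaryIndex o W := by
  classical
  let p : Chain C (n + 1) →ₗ[ℤ] ({e : RelCWComplex.cell C (n + 1) // e ∉ W} → ℤ) :=
    LinearMap.pi fun e => (o.basis (n + 1)).coord e
  have hp : Function.Surjective p := by
    intro v
    refine ⟨∑ e, v e • o.basis (n + 1) e, ?_⟩
    ext e'
    simp [p, Finsupp.single_apply, Subtype.val_inj]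
  have hker : LinearMap.ker p = chainsOf o (subcomplexOf W) (n + 1) := by
    ext x
    rw [chainsOf_subcomplexOf, Basis.mem_span_image, LinearMap.mem_ker, funext_iff]
    simp only [Set.subset_def, Finset.mem_coe, Finsupp.mem_support_iff, p,
      LinearMap.pi_apply, Basis.coord_apply, Pi.zero_apply, Subtype.forall]
    exact forall_congr' fun e => not_imp_comm
  have h := LinearMap.index_map_ker_eq_relIndex p (boundary C (n + 1) n) hp
  rw [hker] at h
  have hrange : LinearMap.range (restrictionMap o W) =
      (LinearMap.ker (boundary C (n + 1) n)).map p := by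
    have h1 : restrictionMap o W = p ∘ₗ (cycles C (n + 1)).subtype := rfl
    rw [h1, LinearMap.range_comp, Submodule.range_subtype]
    rfl
  rw [hrange, h]
  rfl

theorem cycleRank_add_boundaryRank (o : Orientation C) (n : ℕ) :
    cycleRank C (n + 1) + boundaryRank C n = Fintype.card (RelCWComplex.cell C (n + 1)) := by
  have := Chain.finite o (n + 1)
  rw [← finrank_eq_card_basis (o.basis (n + 1)),
    ← LinearMap.finrank_range_add_finrank_ker_int (boundary C (n + 1) n), add_comm]
  rfl

/-- Rank-nullity for `j_W`, whose image has full rank `|Wᶜ| = z_d - k`. -/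
theorem finrank_cyclesOf (o : Orientation C) {n : ℕ} (k : ℕ)
    (W : Finset (RelCWComplex.cell C (n + 1))) (hW : IsAugmentedForest o k W) :
    finrank ℤ (cyclesOf o (subcomplexOf W) (n + 1)) = k := by
  classical
  have := Chain.finite o (n + 1)
  rw [isAugmentedForest_iff, ← index_range_restrictionMap] at hW
  have hfin : Finite (_ ⧸ LinearMap.range (restrictionMap o W)) := Nat.finite_of_card_ne_zero hW.2
  have h1 := LinearMap.finrank_range_add_finrank_ker_int (restrictionMap o W)
  have h2 : finrank ℤ (cyclesOf o (subcomplexOf W) (n + 1)) =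
      finrank ℤ (LinearMap.ker (restrictionMap o W)) := by
    rw [← range_cyclesInclusion, LinearMap.finrank_range_of_inj]
    exact Submodule.inclusion_injective _
  rw [(Submodule.finiteQuotient_iff _).1 hfin, finrank_fintype_fun_eq_card, ← h2] at h1
  have h3 := cycleRank_add_boundaryRank o n
  have h4 : Fintype.card {e // e ∉ W} = Fintype.card (RelCWComplex.cell C (n + 1)) - W.card := by
    rw [Fintype.card_subtype_compl, Fintype.card_coe]
  have h5 := Finset.card_le_univ W
  rw [cycleRank] at h3
  omega

/-! ### Covolumes as minors, and the coefficients of the characteristic polynomial -/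

variable {d : ℕ} (z : Basis (Fin (cycleRank C d)) ℤ (cycles C d))

open Classical in
theorem covolumeSq_eq_det (o : Orientation C) (W : Finset (RelCWComplex.cell C d)) :
    covolumeSq o z W = (LinearMap.toMatrix z (Pi.basisFun ℤ _) (restrictionMap o W) *
      (LinearMap.toMatrix z (Pi.basisFun ℤ _) (restrictionMap o W)).transpose).det := by
  rw [covolumeSq, ← LinearMap.det_toMatrix (Pi.basisFun ℤ _),
    LinearMap.toMatrix_comp _ z _, restrictionAdjoint, LinearMap.toMatrix_toLin]

open Classical in
theorem covolumeSq_eq_minor (o : Orientation C) (W : Finset (RelCWComplex.cell C d)) :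
    covolumeSq o z W = ((inclusionMatrix o z * (inclusionMatrix o z).transpose).submatrix
      (Subtype.val : (Wᶜ : Finset _) → _) (Subtype.val : (Wᶜ : Finset _) → _)).det := by
  rw [covolumeSq_eq_det, ← Matrix.det_submatrix_equiv_self
    (Equiv.subtypeEquivRight (p := fun e => e ∉ W) (q := fun e => e ∈ Wᶜ) (by simp))]
  rfl

/-- Discards the minors that do not come from forests: if `j_W j_W*` is injective, the image of
`j_W` has full rank. -/
theorem boundaryIndex_ne_zero_of_covolumeSq_ne_zero (o : Orientation C) {n : ℕ}
    (z : Basis (Fin (cycleRank C (n + 1))) ℤ (cycles C (n + 1)))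
    (W : Finset (RelCWComplex.cell C (n + 1))) (h : covolumeSq o z W ≠ 0) :
    boundaryIndex o W ≠ 0 := by
  classical
  rw [← index_range_restrictionMap]
  have hinj : Function.Injective (restrictionMap o W ∘ₗ restrictionAdjoint o z W) := by
    rw [← LinearMap.ker_eq_bot]
    by_contra hne
    exact h (LinearMap.det_eq_zero_iff_ker_ne_bot.2 hne)
  have hfin : Finite (_ ⧸ LinearMap.range (restrictionMap o W)) := by
    rw [Submodule.finiteQuotient_iff]
    refine le_antisymm (Submodule.finrank_le _) ?_
    rw [← LinearMap.finrank_range_of_inj hinj]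
    exact Submodule.finrank_mono (LinearMap.range_comp_le_range _ _)
  exact AddSubgroup.index_ne_zero_iff_finite.2 hfin

theorem covolumeSq_eq (o : Orientation C) {n : ℕ}
    (z : Basis (Fin (cycleRank C (n + 1))) ℤ (cycles C (n + 1)))
    (W : Finset (RelCWComplex.cell C (n + 1)))
    (y : Basis (Fin (finrank ℤ (cyclesOf o (subcomplexOf W) (n + 1)))) ℤ
      (cyclesOf o (subcomplexOf W) (n + 1))) (h : boundaryIndex o W ≠ 0) :
    (covolumeSq o z W : ℚ) = torsionRatio o W ^ 2 *
      (((augMatrix o z W y).transpose * augMatrix o z W y).det : ℚ) := by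
  classical
  have h1 := LinearMap.det_toMatrix_mul_transpose z y (cyclesInclusion o W) (restrictionMap o W)
    (Submodule.inclusion_injective _) (range_cyclesInclusion o W)
    (by rwa [index_range_restrictionMap])
  rw [index_range_restrictionMap] at h1
  rw [covolumeSq_eq_det, h1, torsionRatio_eq o W h]
  push_cast
  rfl

theorem meshMatrix_eq (o : Orientation C) :
    meshMatrix o z = (inclusionMatrix o z).transpose * inclusionMatrix o z := by
  ext i j
  simp [meshMatrix, pairing, Matrix.mul_apply, inclusionMatrix, LinearMap.toMatrix_apply]

theorem coeff_charpoly_meshMatrix (o : Orientation C) {n : ℕ}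
    (z : Basis (Fin (cycleRank C (n + 1))) ℤ (cycles C (n + 1))) (k : ℕ)
    (hk : k ≤ cycleRank C (n + 1)) :
    (-1) ^ (cycleRank C (n + 1) - k) * (meshMatrix o z).charpoly.coeff k =
      ∑ W ∈ augmentedForests o (n + 1) k, covolumeSq o z W := by
  classical
  have hcard := cycleRank_add_boundaryRank o n
  have h := Matrix.charpoly_transpose_mul_self_coeff (inclusionMatrix o z)
    (by rw [Fintype.card_fin]; omega) k (by rwa [Fintype.card_fin])
  rw [Fintype.card_fin, ← meshMatrix_eq] at h
  rw [h]
  symm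
  -- Complementation embeds the `k`-augmented forests in the index sets of size `z_d - k`, as `z_d +
  -- b_{d-1}` counts the cells; the minors on the remaining sets vanish.
  refine Finset.sum_of_injOn (fun W => Wᶜ) (compl_injective.injOn) ?_ ?_ ?_
  · intro W hW
    have hW' := ((isAugmentedForest_iff o k W).1 (Finset.mem_filter.1 hW).2).1
    simp only [Finset.subset_univ, true_and, Finset.mem_coe, Finset.mem_powersetCard, Finset.card_compl]
    omega
  · intro J hJ hJ'
    by_contra hne
    refine hJ' ⟨Jᶜ, ?_, compl_compl J⟩
    have hJc := (Finset.mem_powersetCard.1 hJ).2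
    refine Finset.mem_coe.2 (Finset.mem_filter.2 ⟨Finset.mem_univ _, ?_⟩)
    refine (isAugmentedForest_iff o k _).2 ⟨by rw [Finset.card_compl]; omega, ?_⟩
    refine boundaryIndex_ne_zero_of_covolumeSq_ne_zero o z _ ?_
    rw [covolumeSq_eq_minor, compl_compl]
    exact hne
  · intro W _
    exact covolumeSq_eq_minor z o W

end FiniteType

/-! ### Eigenvalues and the final assembly -/

theorem card_eigenvaluesOf {n : ℕ} (M : Matrix (Fin n) (Fin n) ℤ) :
    (eigenvaluesOf M).card = n := by
  rw [eigenvaluesOf, ← (IsAlgClosed.splits _).natDegree_eq_card_roots,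
    Matrix.charpoly_natDegree_eq_dim, Fintype.card_fin]

theorem esymm_eigenvaluesOf {n : ℕ} (M : Matrix (Fin n) (Fin n) ℤ) {k : ℕ} (hk : k ≤ n) :
    (((-1) ^ (n - k) * M.charpoly.coeff k : ℤ) : ℂ) = (eigenvaluesOf M).esymm (n - k) := by
  have hdeg : (M.map (Int.cast : ℤ → ℂ)).charpoly.natDegree = n := by
    rw [Matrix.charpoly_natDegree_eq_dim, Fintype.card_fin]
  have h := Polynomial.coeff_eq_esymm_roots_of_splits
    (IsAlgClosed.splits (M.map (Int.cast : ℤ → ℂ)).charpoly) (k := k) (by rwa [hdeg])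
  have hmap : (M.map (Int.cast : ℤ → ℂ)).charpoly = M.charpoly.map (Int.castRingHom ℂ) :=
    Matrix.charpoly_map M (Int.castRingHom ℂ)
  rw [hdeg, (Matrix.charpoly_monic _).leadingCoeff, one_mul] at h
  have hcoeff : (M.map (Int.cast : ℤ → ℂ)).charpoly.coeff k = (M.charpoly.coeff k : ℂ) := by
    rw [hmap, Polynomial.coeff_map]
    rfl
  push_cast
  rw [← hcoeff, h, ← mul_assoc, ← mul_pow]
  simp [eigenvaluesOf]

end CellMesh

theorem theorem1 {X : Type*} [TopologicalSpace X] [T2Space X] (C : Set X) [CWComplex C]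
    [CWComplex.Finite C] (o : Orientation C) (d : ℕ) (hd : 1 ≤ d)
    (z : Basis (Fin (cycleRank C d)) ℤ (cycles C d))
    (y : ∀ W : Finset (RelCWComplex.cell C d),
      Basis (Fin (finrank ℤ (cyclesOf o (subcomplexOf W) d))) ℤ
        (cyclesOf o (subcomplexOf W) d)) :
    -- the mesh matrix is `Aᵗ A`
    meshMatrix o z = (inclusionMatrix o z).transpose * inclusionMatrix o z ∧
    -- the determinant
    ((-1) ^ cycleRank C d * (meshMatrix o z).charpoly.coeff 0 = (meshMatrix o z).det ∧
      ((meshMatrix o z).det : ℂ) = (eigenvaluesOf (meshMatrix o z)).prod ∧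
      ((meshMatrix o z).det : ℂ) = (eigenvaluesOf (meshMatrix o z)).esymm (cycleRank C d) ∧
      ((meshMatrix o z).det : ℚ) = ∑ V ∈ spanningForests o d, torsionRatio o V ^ 2) ∧
    (∀ V : Finset (RelCWComplex.cell C d), IsSpanningForest o V →
      (covolumeSq o z V : ℚ) = torsionRatio o V ^ 2) ∧
    -- the other coefficients of the characteristic polynomial
    (∀ k : ℕ, 0 < k → k < cycleRank C d →
      (((-1) ^ (cycleRank C d - k) * (meshMatrix o z).charpoly.coeff k : ℤ) : ℂ) =
          (eigenvaluesOf (meshMatrix o z)).esymm (cycleRank C d - k) ∧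
        (((-1) ^ (cycleRank C d - k) * (meshMatrix o z).charpoly.coeff k : ℤ) : ℚ) =
          ∑ W ∈ augmentedForests o d k, torsionRatio o W ^ 2 *
            (((augMatrix o z W (y W)).transpose * augMatrix o z W (y W)).det : ℚ)) ∧
    (∀ k : ℕ, k < cycleRank C d → ∀ W : Finset (RelCWComplex.cell C d),
      IsAugmentedForest o k W →
        (covolumeSq o z W : ℚ) = torsionRatio o W ^ 2 *
          (((augMatrix o z W (y W)).transpose * augMatrix o z W (y W)).det : ℚ)) ∧
    -- integrality; `Z_d(X_W; ℤ)` has rank `k`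
    (∀ (k : ℕ) (W : Finset (RelCWComplex.cell C d)), IsAugmentedForest o k W →
      finrank ℤ (cyclesOf o (subcomplexOf W) d) = k ∧
        ∃ m : ℕ, 0 < m ∧ torsionRatio o W = m) := by
  classical
  -- With `d ≥ 1`, the truncated `d - 1` is a true predecessor.
  obtain ⟨n, rfl⟩ : ∃ n, d = n + 1 := ⟨d - 1, by omega⟩
  have hcov : ∀ (k : ℕ) (W : Finset (RelCWComplex.cell C (n + 1))), IsAugmentedForest o k W →
      (covolumeSq o z W : ℚ) = torsionRatio o W ^ 2 *
        (((augMatrix o z W (y W)).transpose * augMatrix o z W (y W)).det : ℚ) :=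
    fun k W hW => covolumeSq_eq o z W (y W) ((isAugmentedForest_iff o k W).1 hW).2
  have hforest : ∀ V : Finset (RelCWComplex.cell C (n + 1)),
      IsSpanningForest o V ↔ IsAugmentedForest o 0 V := fun V => by
    rw [isSpanningForest_iff, isAugmentedForest_iff, add_zero]
  have hcov0 : ∀ V : Finset (RelCWComplex.cell C (n + 1)), IsSpanningForest o V →
      (covolumeSq o z V : ℚ) = torsionRatio o V ^ 2 := fun V hV => by
    have h0 := finrank_cyclesOf o 0 V ((hforest V).1 hV)
    -- A spanning forest carries no nonzero `d`-cycles, so the Gram determinant is that of an empty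
    -- matrix, namely `1`.
    have : IsEmpty (Fin (finrank ℤ (cyclesOf o (subcomplexOf V) (n + 1)))) := by
      rw [h0]
      infer_instance
    rw [hcov 0 V ((hforest V).1 hV), Matrix.det_isEmpty, Int.cast_one, mul_one]
  have hdet : (-1) ^ cycleRank C (n + 1) * (meshMatrix o z).charpoly.coeff 0 =
      (meshMatrix o z).det := by
    rw [Matrix.det_eq_sign_charpoly_coeff, Fintype.card_fin]
  have hesymm : ((meshMatrix o z).det : ℂ) =
      (eigenvaluesOf (meshMatrix o z)).esymm (cycleRank C (n + 1)) := by
    rw [← hdet]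
    exact esymm_eigenvaluesOf (meshMatrix o z) (Nat.zero_le _)
  refine ⟨meshMatrix_eq z o, ⟨hdet, ?_, hesymm, ?_⟩, hcov0, ?_, fun k _ W hW => hcov k W hW,
    fun k W hW => ⟨finrank_cyclesOf o k W hW, boundaryIndex o W, ?_, ?_⟩⟩
  · have h : (eigenvaluesOf (meshMatrix o z)).esymm (eigenvaluesOf (meshMatrix o z)).card =
        (eigenvaluesOf (meshMatrix o z)).prod := by
      simp [Multiset.esymm, Multiset.powersetCard_self]
    rw [hesymm, ← h, card_eigenvaluesOf]
  · have h := coeff_charpoly_meshMatrix o z 0 (Nat.zero_le _)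
    rw [Nat.sub_zero, hdet] at h
    rw [h, Int.cast_sum]
    refine Finset.sum_congr ?_ fun V hV => hcov0 V (Finset.mem_filter.1 hV).2
    ext V
    simp [augmentedForests, spanningForests, hforest]
  · intro k _ hk
    refine ⟨esymm_eigenvaluesOf (meshMatrix o z) hk.le, ?_⟩
    rw [coeff_charpoly_meshMatrix o z k hk.le, Int.cast_sum]
    exact Finset.sum_congr rfl fun W hW => hcov k W (Finset.mem_filter.1 hW).2
  · exact Nat.pos_of_ne_zero ((isAugmentedForest_iff o k W).1 hW).2
  · exact torsionRatio_eq o W ((isAugmentedForest_iff o k W).1 hW).2
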